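/- Let $n,v,\ell$ be integers with $2\le v\le n$ and $0\le \ell\le n-1$, put $k=n-1-\ell$, and let $F$ be a field. Let $$f_\ell(t)=\frac{1}{(1-\ell t)(1+t)^\ell}=\sum_{i\ge 0}a_it^i .$$ **Johnson graph codes.** For a finite set $E$, let $J(E,u)$ be the set of $u$-subsets of $E$; for $A\subseteq E$ let $B_r(A)=\{L\in J(E,u):\min(|L\setminus A|,|A\setminus L|)\le r\}$. A code $JGC(|E|,u,\kappa,r)$ is a linear code $C\subseteq F^{J(E,u)}$ such that for every $\kappa$-subset $A\subseteq E$ the set $B_r(A)$ is an information set (restriction $C\to F^{B_r(A)}$ is bijective). **Concatenated code.** Let $N=\{0,\dots,n-1\}$ be the set of nodes. For $0\le i<v$ take $a_i$ copies of the layered code with layers of size $v-i$: in each copy, each node $x$ of a layer $L\subseteq N$, $|L|=v-i$, stores a symbol in $F$. The layers of size $v$ (one copy, $a_0=1$) satisfy the check that the sum of their symbols is $0$. For $W\subseteq N$ with $|W|=w=v-i$, $0\le s<i$, $d=i-s$, each copy $p$ of the layered code with layers of size $v-s=w+d$, and $1\le m\le d-1$, the layers $L=W\cup L'$ of copy $p$,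 with $L'\in J(N\setminus W,d)$, are labeled with a linear combination of their symbols (the coefficients may depend on $W,p,m,L$). These $d-1$ labels of $L$, together with the sum of the symbols in $L$, determine the symbols of $L$ at the nodes in $L'$ from those at the nodes in $W$. A linear map $H=H_{W,p,m}:F^{J(N\setminus W,d)}\to F^{\binom{n-k}{d}}$ is given that is surjective with kernel a code $JGC(n-w,\,d,\,k-w,\,\min(d,k-w)-1)$. (Both requirements are imposed for $w\le k$ only; for $w>k$ the labels and the linear map $H$ are arbitrary.) The $\binom{n-k}{d}$ entries of $H$ applied to the labeling are helper symbols of $W$. For $0<i<v$ the helper symbols of a layer $W$ of size $v-i$, over all choices of $s,p,m$, are assigned bijectively to the $a_i$ copies, and the check of $W$ in a copy is that the sum of its symbols equals the helper symbol assigned to that copy. The words that satisfy all these checks form the concatenated code $\mathcal C$. The data code $\mathcal D\subseteq\mathcal C$ consists of the words for which all helper symbols of the empty layer ($W=\emptyset$, $i=v$) are zero, i.e. whose labelings for $W=\emptyset$ are codewords of the Johnson graph codes. **Proposition.** (a) All $a_i$ are nonnegative integers, and the construction can be carried out over every field $F$ with at least $n$ elements. (b) For every field $F$ and all choices in the construction,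 and for every set $A$ of $k$ nodes: 1. the symbols of a word in $\mathcal C$ that are stored in the nodes of $A$ determine all symbols of that word in all layers (of all copies) that meet $A$; 2. the symbols of a word in $\mathcal D$ that are stored in the nodes of $A$ determine the word. Thus the data is recoverable from any $k=n-1-\ell$ nodes. Moreover $$\dim_F\mathcal D=\sum_{i=0}^{v-1}a_i\binom{n}{v-i}(v-i-1)\;-\;a_v .$$ -/

import Mathlib

open Finset

noncomputable section

namespace LayeredCode

/-- The power series `f_ℓ(t) = 1 / ((1 - ℓ t) (1 + t)^ℓ)`.  The constant coefficient of the
denominator is `1`, so `⁻¹` is its inverse. -/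
def genFun (ℓ : ℕ) : PowerSeries ℚ :=
  ((1 - (ℓ : PowerSeries ℚ) * PowerSeries.X) * (1 + PowerSeries.X) ^ ℓ)⁻¹

/-- The multiplicity `a_i`: the coefficient of `t^i` in `f_ℓ(t)`, as a natural number. -/
def copies (ℓ i : ℕ) : ℕ := ⌊PowerSeries.coeff i (genFun ℓ)⌋₊

/-- The generalized neighbourhood `B_r(A)` in the Johnson graph whose vertices are the `v`-subsets
of `E`: the vertices `L` with `min (|L \ A|) (|A \ L|) ≤ r`.  It is empty for `r = -1`. -/
def genBall {V : Type*} [DecidableEq V] (E : Finset V) (v : ℕ) (A : Finset V) (r : ℤ) :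
    Set (E.powersetCard v) :=
  {L | ((min (L.1 \ A).card (A \ L.1).card : ℕ) : ℤ) ≤ r}

/-- `C` is a Johnson graph code `JGC(|E|, v, k, r)` on the `v`-subsets of `E`: for each `k`-subset
`A` of `E` the coordinates in `B_r(A)` form an information set, that is, restricting codewords
to `B_r(A)` is a bijection of `C` with all the labelings of `B_r(A)` (so `dim C = |B_r(A)|`). -/
def IsJohnsonGraphCode {F V : Type*} [Field F] [DecidableEq V] (E : Finset V) (v k : ℕ) (r : ℤ)
    (C : Submodule F (E.powersetCard v → F)) : Prop :=
  ∀ A : Finset V, A ⊆ E → A.card = k →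
    Function.Bijective (fun (c : C) (L : genBall E v A r) => c.1 L.1)

/-- The words: `c i p L x` is the symbol that node `x` stores for the layer `L` in the `p`-th copy
(out of `a_i`) of the layered code with layers of size `v - i`.  As in the array format of
layered codes, the codes below have the assigned value `0` when `|L| ≠ v - i` or `x ∉ L`. -/
abbrev Word (F : Type*) (n ℓ : ℕ) : Type _ :=
  (i : ℕ) → Fin (copies ℓ i) → Finset (Fin n) → Fin n → F

/-- A channel by which the layers of size `v - i` help larger layers: the index `src < i`, for
helped layers of size `v - src`, the copy of the layered code with such layers that is helped, and
one of the `d - 1` labels of a helped layer, where `d = i - src` is the difference in size. -/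
structure Channel (ℓ i : ℕ) where
  src : Fin i
  copy : Fin (copies ℓ src)
  slot : Fin (i - src - 1)

/-- The helper symbols of a layer of size `v - i`: each channel with difference `d` transmits
`binom (ℓ + 1) d` parities (note `ℓ + 1 = n - k`). -/
abbrev Helper (ℓ i : ℕ) : Type :=
  Σ ch : Channel ℓ i, Fin ((ℓ + 1).choose (i - ch.src))

/-- The choices in the construction of the concatenated code on `n` nodes, with top layers of size
`v`, for data collection from `k = n - 1 - ℓ` nodes. -/
structure Gluing (F : Type*) [Field F] (n v k ℓ : ℕ) where
  /-- Each of the `a_i` copies of a layer of size `v - i` (`0 < i < v`) holds exactly one of the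
  helper symbols of this layer. -/
  assign : ∀ i : ℕ, 0 < i → i < v → Fin (copies ℓ i) ≃ Helper ℓ i
  /-- The coefficients of the label (a linear combination of the symbols) of a layer `W ∪ L'`
  that contains the layer `W` of size `v - i`, where `L'` is disjoint from `W`. -/
  coef : (i : ℕ) → Finset (Fin n) → Channel ℓ i → Finset (Fin n) → Fin n → F
  /-- The `d - 1` labels and the sum of the symbols of the layer `W ∪ L'`, with `|L'| = d`,
  suffice to recover the symbols in the nodes of `L'` from the other symbols of the layer. -/
  coef_recover : ∀ (i : ℕ) (W : Finset (Fin n)), W.card + i = v → W.card ≤ k →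
    ∀ (s : Fin i) (p : Fin (copies ℓ s)) (L' : Finset (Fin n)),
      Disjoint W L' → L'.card = i - s →
      ∀ y : Fin n → F, ∑ x ∈ L', y x = 0 →
        (∀ m : Fin (i - s - 1), ∑ x ∈ L', coef i W ⟨s, p, m⟩ L' x * y x = 0) →
        ∀ x ∈ L', y x = 0
  /-- The parity checks on labelings of the layers that contain `W`; such layers `W ∪ L'` are the
  vertices `L'` of a Johnson graph on the complement of `W`. -/
  check : (i : ℕ) → (W : Finset (Fin n)) → (ch : Channel ℓ i) →
    (Wᶜ.powersetCard (i - ch.src) → F) →ₗ[F] (Fin ((ℓ + 1).choose (i - ch.src)) → F)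
  /-- They are a full set of independent parity checks of a Johnson graph code
  `JGC(n - w, d, k - w, min (d, k - w) - 1)`, with `w = |W| ≤ k`. -/
  check_surjective : ∀ (i : ℕ) (W : Finset (Fin n)), W.card + i = v → W.card ≤ k →
    ∀ ch : Channel ℓ i, Function.Surjective (check i W ch)
  check_isJohnsonGraphCode : ∀ (i : ℕ) (W : Finset (Fin n)), W.card + i = v → W.card ≤ k →
    ∀ ch : Channel ℓ i,
      IsJohnsonGraphCode Wᶜ (i - ch.src) (k - W.card)
        ((min (i - ch.src) (k - W.card) : ℕ) - 1 : ℤ) (LinearMap.ker (check i W ch))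

namespace Gluing

variable {F : Type*} [Field F] {n v k ℓ : ℕ}

/-- The labeling, for a given channel, of the layers `W ∪ L'` that contain `W`. -/
def label (G : Gluing F n v k ℓ) (i : ℕ) (W : Finset (Fin n)) (ch : Channel ℓ i) :
    Word F n ℓ →ₗ[F] (Wᶜ.powersetCard (i - ch.src) → F) where
  toFun c := fun L' => ∑ x ∈ W ∪ L'.1, G.coef i W ch L'.1 x * c ch.src ch.copy (W ∪ L'.1) x
  map_add' c c' := by
    funext L'
    simp [mul_add, Finset.sum_add_distrib]
  map_smul' a c := by
    funext L'
    simp [Finset.mul_sum, mul_left_comm]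

/-- The concatenated layered code: one layered code with layers of size `v`, whose layers have
check sum zero, and `a_i` copies of the layered code with layers of size `v - i`, `0 < i < v`,
in which the check sum of a layer equals the helper symbol that is assigned to it. -/
def concatCode (G : Gluing F n v k ℓ) : Submodule F (Word F n ℓ) where
  carrier := {c |
    (∀ i p L x, ¬ (L.card + i = v ∧ x ∈ L) → c i p L x = 0) ∧
    (∀ p L, L.card = v → ∑ x ∈ L, c 0 p L x = 0) ∧
    (∀ (i : ℕ) (h0 : 0 < i) (hv : i < v) (p : Fin (copies ℓ i)) (W : Finset (Fin n)),
      W.card + i = v →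
      ∑ x ∈ W, c i p W x =
        G.check i W (G.assign i h0 hv p).1 (G.label i W (G.assign i h0 hv p).1 c)
          (G.assign i h0 hv p).2)}
  add_mem' := by
    rintro c c' ⟨h1, h2, h3⟩ ⟨h1', h2', h3'⟩
    refine ⟨fun i p L x h => ?_, fun p L h => ?_, fun i h0 hv p W h => ?_⟩
    · simp [h1 i p L x h, h1' i p L x h]
    · simp [Finset.sum_add_distrib, h2 p L h, h2' p L h]
    · simp only [Pi.add_apply, map_add, Finset.sum_add_distrib, h3 i h0 hv p W h,
        h3' i h0 hv p W h]
  zero_mem' := by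
    refine ⟨fun i p L x h => rfl, fun p L h => by simp, fun i h0 hv p W h => by simp⟩
  smul_mem' := by
    rintro a c ⟨h1, h2, h3⟩
    refine ⟨fun i p L x h => ?_, fun p L h => ?_, fun i h0 hv p W h => ?_⟩
    · simp [h1 i p L x h]
    · simp [← Finset.mul_sum, h2 p L h]
    · simp only [Pi.smul_apply, map_smul, ← Finset.smul_sum, h3 i h0 hv p W h]

/-- The words of the concatenated code in which the labelings by the channels of the empty layer
`W = ∅` (where no helper symbols can be stored) are codewords of the Johnson graph codes
`JGC(n, u, k, min (u, k) - 1)`, for the layer sizes `u` that occur. -/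
def dataCode (G : Gluing F n v k ℓ) : Submodule F (Word F n ℓ) :=
  G.concatCode ⊓ ⨅ ch : Channel ℓ v, (LinearMap.ker (G.check v ∅ ch)).comap (G.label v ∅ ch)

end Gluing

end LayeredCode

end

/-! ### The multiplicities: a recurrence that counts helper symbols. -/

noncomputable section

namespace LayeredCode

/-! Multiplicities. The denominator of `genFun ℓ` is `1 - ∑_{d ≥ 1} (d-1) * binom(ℓ+1, d) * t^d`, so
`a_i` is the sum over `s < i` of `a_s * (i-s-1) * binom(ℓ+1, i-s)`. This is exactly the number of
helper symbols of a layer of size `v - i`, which gives integrality, nonnegativity and the assignment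
of helper symbols to copies.

Existence. Take Vandermonde coefficients for the labels. As parity-check column at `L'`, take the
wedge of the Vandermonde vectors in `F^(ℓ+1)` indexed by `L'`.

Recovery. By linearity, consider a word that vanishes on the `k` nodes of `A`, and induct downwards
on `|L ∩ A| + |L|` (`layer_eq_zero_of_check_eq_zero`). Put `W = L ∩ A`. The check sum of `L` is
zero, as its helper symbol comes from larger layers. If the helper symbols of `W` vanish, the
labeling for `W` is a codeword; its entries at layers meeting `A \ W` vanish by induction, and these
form an information set. So all labels of `L` vanish, and hence `L` does. The helper symbols of a
nonempty `W ⊆ A` are stored inside `A`; those of the empty layer vanish in the data code only.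

Dimension. A layer of size `u` has `u` symbols, against one check sum and `u - 1` labels for the
empty layer. The map to these quantities is injective, hence bijective, so the checks are
independent. The `a_v` helper symbols of the empty layer are independent further conditions. -/

theorem coeff_one_add_X_pow (ℓ d : ℕ) :
    PowerSeries.coeff d ((1 + PowerSeries.X : PowerSeries ℚ) ^ ℓ) = ℓ.choose d := by
  have h : (1 + PowerSeries.X : PowerSeries ℚ) ^ ℓ =
      (((1 + Polynomial.X) ^ ℓ : Polynomial ℚ) : PowerSeries ℚ) := by simp
  rw [h, Polynomial.coeff_coe, Polynomial.coeff_one_add_X_pow]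

/-- For layers that differ in size by `d + 1`, the factor `d` counts the labels and the binomial the
parities per label. -/
theorem coeff_genFun_denominator (ℓ d : ℕ) :
    PowerSeries.coeff (d + 1)
      ((1 - (ℓ : PowerSeries ℚ) * PowerSeries.X) * (1 + PowerSeries.X) ^ ℓ) =
      -(d * (ℓ + 1).choose (d + 1) : ℚ) := by
  have e : (1 - (ℓ : PowerSeries ℚ) * PowerSeries.X) * (1 + PowerSeries.X) ^ ℓ =
      (1 + PowerSeries.X) ^ ℓ - ℓ • ((1 + PowerSeries.X) ^ ℓ * PowerSeries.X) := by
    rw [nsmul_eq_mul]; ring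
  rw [e, map_sub, map_nsmul, PowerSeries.coeff_succ_mul_X, coeff_one_add_X_pow,
    coeff_one_add_X_pow, nsmul_eq_mul]
  have h1 : ((ℓ + 1 : ℕ) * ℓ.choose d : ℚ) = (ℓ + 1).choose (d + 1) * (d + 1 : ℕ) := by
    exact_mod_cast Nat.add_one_mul_choose_eq ℓ d
  have h2 : ((ℓ + 1).choose (d + 1) : ℚ) = ℓ.choose d + ℓ.choose (d + 1) := by
    exact_mod_cast Nat.choose_succ_succ ℓ d
  push_cast at h1
  linarith

theorem genFun_mul_denominator (ℓ : ℕ) :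
    genFun ℓ * ((1 - (ℓ : PowerSeries ℚ) * PowerSeries.X) * (1 + PowerSeries.X) ^ ℓ) = 1 :=
  PowerSeries.inv_mul_cancel _ (by simp)

theorem coeff_zero_genFun (ℓ : ℕ) : PowerSeries.coeff 0 (genFun ℓ) = 1 := by
  have h := congrArg (PowerSeries.coeff 0) (genFun_mul_denominator ℓ)
  simpa using h

theorem coeff_genFun_succ (ℓ i : ℕ) :
    PowerSeries.coeff (i + 1) (genFun ℓ) = ∑ s ∈ range (i + 1),
      PowerSeries.coeff s (genFun ℓ) * (((i - s) * (ℓ + 1).choose (i + 1 - s) : ℕ) : ℚ) := by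
  have h := congrArg (PowerSeries.coeff (i + 1)) (genFun_mul_denominator ℓ)
  rw [PowerSeries.coeff_mul, Finset.Nat.sum_antidiagonal_eq_sum_range_succ_mk,
    Finset.sum_range_succ] at h
  have h0 : ∀ s ∈ range (i + 1), PowerSeries.coeff s (genFun ℓ) *
      PowerSeries.coeff (i + 1 - s)
        ((1 - (ℓ : PowerSeries ℚ) * PowerSeries.X) * (1 + PowerSeries.X) ^ ℓ) =
      -(PowerSeries.coeff s (genFun ℓ) *
        (((i - s) * (ℓ + 1).choose (i + 1 - s) : ℕ) : ℚ)) := by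
    intro s hs
    have hs' : i + 1 - s = (i - s) + 1 := by have := mem_range.1 hs; omega
    rw [hs', coeff_genFun_denominator]
    push_cast
    ring
  rw [Finset.sum_congr rfl h0, Finset.sum_neg_distrib] at h
  have h1 : PowerSeries.coeff 0
      ((1 - (ℓ : PowerSeries ℚ) * PowerSeries.X) * (1 + PowerSeries.X) ^ ℓ) = 1 := by simp
  rw [Nat.sub_self, h1, PowerSeries.coeff_one, if_neg (Nat.succ_ne_zero i)] at h
  linarith

/-- The coefficients of `genFun ℓ` are natural numbers. -/
theorem cast_copies (ℓ i : ℕ) : (copies ℓ i : ℚ) = PowerSeries.coeff i (genFun ℓ) := by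
  induction i using Nat.strong_induction_on with
  | _ i ih =>
    -- The floor in `copies` loses nothing once the coefficient is known to be a natural number,
    -- which the recurrence with its natural weights provides.
    suffices h : ∃ m : ℕ, PowerSeries.coeff i (genFun ℓ) = m by
      obtain ⟨m, hm⟩ := h
      rw [copies, hm, Nat.floor_natCast]
    cases i with
    | zero => exact ⟨1, by rw [coeff_zero_genFun, Nat.cast_one]⟩
    | succ i =>
      refine ⟨∑ s ∈ range (i + 1), copies ℓ s * ((i - s) * (ℓ + 1).choose (i + 1 - s)), ?_⟩
      rw [coeff_genFun_succ]
      push_cast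
      exact Finset.sum_congr rfl fun s hs => by rw [ih s (mem_range.1 hs)]

theorem copies_eq_sum (ℓ i : ℕ) (hi : 0 < i) :
    copies ℓ i = ∑ s : Fin i, copies ℓ s * ((i - s - 1) * (ℓ + 1).choose (i - s)) := by
  obtain ⟨i, rfl⟩ := Nat.exists_eq_succ_of_ne_zero hi.ne'
  rw [Fin.sum_univ_eq_sum_range
    (fun s => copies ℓ s * ((i + 1 - s - 1) * (ℓ + 1).choose (i + 1 - s)))]
  have h := coeff_genFun_succ ℓ i
  simp_rw [← cast_copies] at h
  rw [Nat.succ_eq_add_one]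
  have h' : copies ℓ (i + 1) =
      ∑ s ∈ range (i + 1), copies ℓ s * ((i - s) * (ℓ + 1).choose (i + 1 - s)) := by
    exact_mod_cast h
  rw [h']
  exact Finset.sum_congr rfl fun s _ => by rw [show i + 1 - s - 1 = i - s by omega]

/-- A channel as a triple. -/
def channelEquiv (ℓ i : ℕ) :
    Channel ℓ i ≃ Σ s : Fin i, Fin (copies ℓ s) × Fin (i - s - 1) where
  toFun ch := ⟨ch.src, ch.copy, ch.slot⟩
  invFun q := ⟨q.1, q.2.1, q.2.2⟩
  left_inv _ := rfl
  right_inv _ := rfl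

instance (ℓ i : ℕ) : Fintype (Channel ℓ i) := Fintype.ofEquiv _ (channelEquiv ℓ i).symm

theorem sum_channel {M : Type*} [AddCommMonoid M] (ℓ i : ℕ) (g : Fin i → M) :
    ∑ ch : Channel ℓ i, g ch.src = ∑ s : Fin i, (copies ℓ s * (i - s - 1)) • g s := by
  rw [← (channelEquiv ℓ i).symm.sum_comp, Fintype.sum_sigma]
  exact Finset.sum_congr rfl fun s _ => by simp [channelEquiv]

/-- The helper symbols of a layer are as many as the copies that have to store them. -/
theorem card_helper (ℓ i : ℕ) (hi : 0 < i) : Fintype.card (Helper ℓ i) = copies ℓ i := by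
  rw [Fintype.card_sigma, copies_eq_sum ℓ i hi]
  simp_rw [Fintype.card_fin]
  rw [sum_channel ℓ i fun s : Fin i => (ℓ + 1).choose (i - s)]
  exact Finset.sum_congr rfl fun s _ => by rw [smul_eq_mul, mul_assoc]

end LayeredCode
end

/-! ### Carrying out the construction: Vandermonde labels and exterior powers. -/

noncomputable section

namespace LayeredCode

variable {F : Type*} [Field F]

theorem linearIndependent_pow_of_card {n m : ℕ} (α : Fin n ↪ F) (S : Finset (Fin n))
    (hS : S.card = m) :
    LinearIndependent F (fun (x : S) (j : Fin m) => α x ^ (j : ℕ)) := by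
  have h : LinearIndependent F
      (Matrix.vandermonde fun i : Fin m => α ((S.equivFinOfCardEq hS).symm i)).row :=
    Matrix.linearIndependent_rows_of_det_ne_zero
      (Matrix.det_vandermonde_ne_zero_iff.2 fun a b hab =>
        (S.equivFinOfCardEq hS).symm.injective (Subtype.ext (α.injective hab)))
  have h' := h.comp _ (S.equivFinOfCardEq hS).injective
  convert h' using 1
  funext x j
  change _ = α ((S.equivFinOfCardEq hS).symm (S.equivFinOfCardEq hS x)) ^ (j : ℕ)
  rw [Equiv.symm_apply_apply]

theorem eq_zero_of_sum_pow_mul_eq_zero {n m : ℕ} (α : Fin n ↪ F) (S : Finset (Fin n))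
    (hS : S.card = m) (y : Fin n → F) (h : ∀ j < m, ∑ x ∈ S, α x ^ j * y x = 0) :
    ∀ x ∈ S, y x = 0 := by
  have hli := Fintype.linearIndependent_iff.1 (linearIndependent_pow_of_card α S hS)
    (fun x => y x) (by
      funext j
      rw [Finset.sum_apply, Pi.zero_apply, ← h j j.2, ← Finset.sum_coe_sort S]
      exact Finset.sum_congr rfl fun x _ => by simp [mul_comm])
  exact fun x hx => hli ⟨x, hx⟩

/-- A linear map on labelings for which the columns in `T` form a basis is surjective, and the
complement of `T` is an information set for its kernel. -/
theorem surjective_and_bijective_restrict {J : Type*} [Fintype J] [DecidableEq J] {N : ℕ}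
    (H : (J → F) →ₗ[F] (Fin N → F)) (T B : Set J) (hB : B = Tᶜ) (hN : Nat.card T = N)
    (hT : LinearIndependent F fun j : T => H (Pi.single j.1 1)) :
    Function.Surjective H ∧
      Function.Bijective fun (c : LinearMap.ker H) (j : B) => c.1 j.1 := by
  classical
  subst hB
  have hcard : Fintype.card T = N := by rw [← hN, Nat.card_eq_fintype_card]
  have hsurj : Function.Surjective H := by
    rw [← LinearMap.range_eq_top, eq_top_iff,
      ← hT.span_eq_top_of_card_eq_finrank' (by simp [hcard]), Submodule.span_le]
    rintro _ ⟨j, rfl⟩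
    exact ⟨_, rfl⟩
  refine ⟨hsurj, ?_⟩
  let R : LinearMap.ker H →ₗ[F] ((Tᶜ : Set J) → F) :=
    { toFun := fun c j => c.1 j.1
      map_add' := fun _ _ => rfl
      map_smul' := fun _ _ => rfl }
  have hinj : Function.Injective R := by
    rw [← LinearMap.ker_eq_bot, LinearMap.ker_eq_bot']
    rintro ⟨c, hc⟩ h0
    have hoff : ∀ j, j ∉ T → c j = 0 := fun j hj => congrFun h0 ⟨j, hj⟩
    -- A kernel word that vanishes off `T` is a linear relation between the columns in `T`.
    have hsum : ∑ j : T, c j.1 • H (Pi.single j.1 1) = 0 := by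
      rw [LinearMap.mem_ker, LinearMap.pi_apply_eq_sum_univ H c] at hc
      have hd := Finset.sum_subtype_of_mem (s := univ.filter (· ∈ T))
        (p := (· ∈ T)) (fun j => c j • H (Pi.single j 1)) (by simp)
      have e1 : ∀ j, H (fun i => if j = i then 1 else 0) = H (Pi.single j 1) := by
        intro j; congr 1; funext i; simp [Pi.single_apply, eq_comm]
      simp_rw [e1] at hc
      rw [← hc, ← Finset.sum_subset (Finset.filter_subset (· ∈ T) univ)
        (fun j _ hj => by rw [hoff j (by simpa using hj), zero_smul]), ← hd]
      exact Finset.sum_congr (by ext; simp) fun _ _ => rfl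
    have hz := Fintype.linearIndependent_iff.1 hT (fun j => c j.1) hsum
    refine Subtype.ext (funext fun j => ?_)
    by_cases hj : j ∈ T
    · exact hz ⟨j, hj⟩
    · exact hoff j hj
  have hdim : Module.finrank F (LinearMap.ker H) = Module.finrank F ((Tᶜ : Set J) → F) := by
    have h1 := H.finrank_range_add_finrank_ker
    rw [LinearMap.range_eq_top.2 hsurj, finrank_top, Module.finrank_fin_fun,
      Module.finrank_fintype_fun_eq_card] at h1
    rw [Module.finrank_fintype_fun_eq_card, Fintype.card_compl_set]
    omega
  exact ⟨hinj, (LinearMap.injective_iff_surjective_of_finrank_eq_finrank hdim).1 hinj⟩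

/-- Both differences lose `|L ∩ A|`, so the minimum is `min d |A| - |L ∩ A|`; it drops below `min d
|A|` exactly when `L` meets `A`. -/
theorem genBall_eq_compl {V : Type*} [DecidableEq V] (E A : Finset V) (d : ℕ) :
    genBall E d A ((min d A.card : ℕ) - 1 : ℤ) =
      {L : E.powersetCard d | Disjoint L.1 A}ᶜ := by
  ext ⟨L, hL⟩
  have hc := (mem_powersetCard.1 hL).2
  have h1 := Finset.card_sdiff_add_card_inter L A
  have h2 := Finset.card_sdiff_add_card_inter A L
  rw [Finset.inter_comm A L] at h2
  have h3 : Disjoint L A ↔ (L ∩ A).card = 0 := by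
    rw [Finset.card_eq_zero, Finset.disjoint_iff_inter_eq_empty]
  simp only [genBall, Set.mem_ofPred_eq, Set.mem_compl_iff, h3]
  omega

theorem card_disjoint_powersetCard {V : Type*} [DecidableEq V] (E A : Finset V) (hA : A ⊆ E)
    (d : ℕ) : Nat.card {L : E.powersetCard d | Disjoint L.1 A} =
      (E.card - A.card).choose d := by
  rw [← Finset.card_sdiff_of_subset hA, ← Finset.card_powersetCard, ← Fintype.card_coe,
    ← Nat.card_eq_fintype_card]
  refine Nat.card_congr
    ⟨fun L => ⟨L.1.1, ?_⟩, fun L => ⟨⟨L.1, ?_⟩, ?_⟩, fun _ => rfl, fun _ => rfl⟩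
  · have := mem_powersetCard.1 L.1.2
    exact mem_powersetCard.2 ⟨subset_sdiff.2 ⟨this.1, L.2⟩, this.2⟩
  · have := mem_powersetCard.1 L.2
    exact mem_powersetCard.2 ⟨this.1.trans sdiff_subset, this.2⟩
  · exact (subset_sdiff.1 (mem_powersetCard.1 L.2).1).2

/-- The exterior products of `d` of the vectors `e x`, `x ∈ S`, are independent if these vectors
are. -/
theorem linearIndependent_ιMulti_of_subset {n d : ℕ} {M : Type*} [AddCommGroup M] [Module F M]
    (e : Fin n → M) (S : Finset (Fin n)) (hS : LinearIndependent F fun x : S => e x)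
    {J : Type*} (φ : J → Set.powersetCard (Fin n) d) (hφ : Function.Injective φ)
    (hφS : ∀ j, (φ j).1 ⊆ S) :
    LinearIndependent F fun j => exteriorPower.ιMulti_family F d e (φ j) := by
  have h := exteriorPower.ιMulti_family_linearIndependent_field d hS
  have hmap : ∀ j, ((φ j).1.subtype (· ∈ S)).map (Function.Embedding.subtype _) = (φ j).1 :=
    fun j => Finset.subtype_map_of_mem fun x hx => hφS j hx
  let ψ : J → Set.powersetCard S d := fun j => ⟨(φ j).1.subtype (· ∈ S), by
    have := congrArg Finset.card (hmap j)
    rw [Finset.card_map] at this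
    exact this.trans (φ j).2⟩
  have hψ : Function.Injective ψ := fun i j hij => hφ (Subtype.ext (by
    rw [← hmap i, ← hmap j]
    exact congrArg (fun s : Set.powersetCard S d => s.1.map (Function.Embedding.subtype _)) hij))
  convert h.comp ψ hψ using 1
  funext j
  rw [Function.comp_apply, exteriorPower.ιMulti_family, exteriorPower.ιMulti_family]
  congr 1
  -- Wedge factors are taken in increasing order, so the enumeration of a `d`-set inside `S` must
  -- agree with the one inside `Fin n`.
  have hu := Finset.orderEmbOfFin_unique (s := (φ j).1) (φ j).2
    (f := fun i => ((ψ j).1.orderEmbOfFin (ψ j).2 i : Fin n))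
    (fun i => by
      have := (ψ j).1.orderEmbOfFin_mem (ψ j).2 i
      simpa [ψ] using this)
    (fun a b hab => ((ψ j).1.orderEmbOfFin (ψ j).2).strictMono hab)
  funext i
  simp only [Function.comp_apply, Set.powersetCard.ofFinEmbEquiv_symm_apply]
  exact congrArg e (congrFun hu i).symm

/-- Johnson graph codes from exterior powers: over a field with at least `n` elements, a full set
of independent parity checks for a code `JGC(n - w, d, k - w, min (d, k - w) - 1)`. -/
theorem exists_johnsonGraphCheck {n k ℓ : ℕ} (hk : k + 1 + ℓ = n) (α : Fin n ↪ F)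
    (W : Finset (Fin n)) (hW : W.card ≤ k) (d : ℕ) :
    ∃ H : (Wᶜ.powersetCard d → F) →ₗ[F] (Fin ((ℓ + 1).choose d) → F),
      Function.Surjective H ∧ IsJohnsonGraphCode Wᶜ d (k - W.card)
        ((min d (k - W.card) : ℕ) - 1 : ℤ) (LinearMap.ker H) := by
  let e : Fin n → (Fin (ℓ + 1) → F) := fun x j => α x ^ (j : ℕ)
  let φ : Wᶜ.powersetCard d → Set.powersetCard (Fin n) d := fun L =>
    ⟨L.1, (mem_powersetCard.1 L.2).2⟩
  have hφ : Function.Injective φ := fun a b hab => Subtype.ext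
    (congrArg (fun s : Set.powersetCard (Fin n) d => s.1) hab)
  -- Any identification serves: only independence of the columns matters.
  let Φ : (⋀[F]^d (Fin (ℓ + 1) → F)) ≃ₗ[F] (Fin ((ℓ + 1).choose d) → F) :=
    LinearEquiv.ofFinrankEq _ _ (by simp [exteriorPower.finrank_eq])
  let H : (Wᶜ.powersetCard d → F) →ₗ[F] (Fin ((ℓ + 1).choose d) → F) :=
    Φ.toLinearMap ∘ₗ
      Fintype.linearCombination F fun L => exteriorPower.ιMulti_family F d e (φ L)
  have hcol : ∀ L, H (Pi.single L 1) = Φ (exteriorPower.ιMulti_family F d e (φ L)) := by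
    intro L
    simp only [H, LinearMap.comp_apply, Fintype.linearCombination_apply_single, one_smul]
    rfl
  have hWc : Wᶜ.card = n - W.card := by rw [card_compl, Fintype.card_fin]
  have key : ∀ A ⊆ Wᶜ, A.card = k - W.card → Function.Surjective H ∧ Function.Bijective
      fun (c : LinearMap.ker H)
        (L : genBall Wᶜ d A ((min d A.card : ℕ) - 1 : ℤ)) => c.1 L.1 := by
    intro A hA hAk
    refine surjective_and_bijective_restrict H {L | Disjoint L.1 A} _
      (genBall_eq_compl Wᶜ A d) ?_ ?_
    · rw [card_disjoint_powersetCard _ _ hA]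
      congr 1
      omega
    -- Here `|Wᶜ \ A| = (n - w) - (k - w) = ℓ + 1`, so these vectors form a basis of `F^(ℓ+1)`.
    · have hS : LinearIndependent F fun x : (Wᶜ \ A : Finset (Fin n)) => e x :=
        linearIndependent_pow_of_card α (Wᶜ \ A) (by
          rw [Finset.card_sdiff_of_subset hA]
          omega)
      have hli := linearIndependent_ιMulti_of_subset e (Wᶜ \ A) hS
        (fun j : {L : Wᶜ.powersetCard d | Disjoint L.1 A} => φ j.1)
        (hφ.comp Subtype.val_injective)
        (fun L => subset_sdiff.2 ⟨(mem_powersetCard.1 L.1.2).1, L.2⟩)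
      have hli' := hli.map' Φ.toLinearMap Φ.ker
      rw [show (fun j : {L : Wᶜ.powersetCard d | Disjoint L.1 A} => H (Pi.single j.1 1)) =
        fun j => Φ (exteriorPower.ιMulti_family F d e (φ j.1)) from funext fun j => hcol j.1]
      exact hli'
  refine ⟨H, ?_, fun A hA hAk => ?_⟩
  · obtain ⟨A, hA, hAk⟩ := Finset.exists_subset_card_eq (s := Wᶜ) (n := k - W.card) (by omega)
    exact (key A hA hAk).1
  · rw [← hAk]
    exact (key A hA hAk).2

/-- The construction can be carried out over every field with at least `n` elements. -/
theorem nonempty_gluing {n v k ℓ : ℕ} (hk : k + 1 + ℓ = n) (α : Fin n ↪ F) :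
    Nonempty (Gluing F n v k ℓ) := by
  classical
  have hH : ∀ (W : Finset (Fin n)) (d : ℕ),
      ∃ H : (Wᶜ.powersetCard d → F) →ₗ[F] (Fin ((ℓ + 1).choose d) → F), W.card ≤ k →
        Function.Surjective H ∧ IsJohnsonGraphCode Wᶜ d (k - W.card)
          ((min d (k - W.card) : ℕ) - 1 : ℤ) (LinearMap.ker H) := by
    intro W d
    by_cases hW : W.card ≤ k
    · obtain ⟨H, h⟩ := exists_johnsonGraphCheck hk α W hW d
      exact ⟨H, fun _ => h⟩
    · exact ⟨0, fun h => absurd h hW⟩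
  choose H hH using hH
  exact ⟨{
    assign := fun i h0 _ => Fintype.equivOfCardEq (by rw [Fintype.card_fin, card_helper ℓ i h0])
    -- The labels use the exponents `1, …, d - 1`; the check sum supplies the exponent `0` of a full
    -- Vandermonde system on `L'`.
    coef := fun i W ch L' x => α x ^ ((ch.slot : ℕ) + 1)
    coef_recover := by
      intro i W _ _ s p L' _ hL' y h0 h1
      refine eq_zero_of_sum_pow_mul_eq_zero α L' hL' y fun j hj => ?_
      cases j with
      | zero => simpa using h0
      | succ j => exact h1 ⟨j, by omega⟩
    check := fun i W ch => H W (i - ch.src)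
    check_surjective := fun i W _ hW ch => (hH W _ hW).1
    check_isJohnsonGraphCode := fun i W _ hW ch => (hH W _ hW).2 }⟩

end LayeredCode
end

/-! ### Recovery from `k` nodes. -/

noncomputable section

namespace LayeredCode
namespace Gluing

variable {F : Type*} [Field F] {n v k ℓ : ℕ} (G : Gluing F n v k ℓ)

theorem label_eq_zero_of_layer_eq_zero {i : ℕ} {W : Finset (Fin n)} (ch : Channel ℓ i)
    {c : Word F n ℓ} (L' : Wᶜ.powersetCard (i - ch.src))
    (h : c ch.src ch.copy (W ∪ L'.1) = 0) : G.label i W ch c L' = 0 :=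
  Finset.sum_eq_zero fun x _ => by rw [h, Pi.zero_apply, mul_zero]

/-- The check sum of a layer is zero if all symbols in the larger layers are zero. -/
theorem sum_layer_eq_zero {c : Word F n ℓ} (hc : c ∈ G.concatCode) {i : ℕ}
    (p : Fin (copies ℓ i)) {L : Finset (Fin n)} (hL : L.card + i = v) (hne : L.Nonempty)
    (hlarge : ∀ i p L', L ⊂ L' → c i p L' = 0) : ∑ x ∈ L, c i p L x = 0 := by
  obtain ⟨_, h2, h3⟩ := hc
  have hpos := hne.card_pos
  rcases Nat.eq_zero_or_pos i with rfl | h0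
  · exact h2 p L hL
  · have hv : i < v := by omega
    rw [h3 i h0 hv p L hL]
    have hz : G.label i L (G.assign i h0 hv p).1 c = 0 := by
      funext L'
      refine G.label_eq_zero_of_layer_eq_zero _ L' (hlarge _ _ _ ?_)
      have hL' := mem_powersetCard.1 L'.2
      have hd : Disjoint L L'.1 := disjoint_of_subset_right hL'.1 disjoint_compl_right
      refine ⟨subset_union_left, fun hsub => ?_⟩
      have := card_le_card hsub
      rw [card_union_of_disjoint hd] at this
      have hs := (G.assign i h0 hv p).1.src.2
      omega
    rw [hz, map_zero, Pi.zero_apply]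

/-- A layer is zero if it is zero on a subset `W` and its check sum and labels for `W` are zero. -/
theorem layer_eq_zero_of_label_eq_zero {c : Word F n ℓ} (hc : c ∈ G.concatCode) {i : ℕ}
    {W : Finset (Fin n)} (hW : W.card + i = v) (hWk : W.card ≤ k) (s : Fin i)
    (p : Fin (copies ℓ s)) (L' : Wᶜ.powersetCard (i - s))
    (hzero : ∀ x ∈ W, c s p (W ∪ L'.1) x = 0) (hsum : ∑ x ∈ W ∪ L'.1, c s p (W ∪ L'.1) x = 0)
    (hlabel : ∀ m, G.label i W ⟨s, p, m⟩ c L' = 0) : c s p (W ∪ L'.1) = 0 := by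
  have hL' := mem_powersetCard.1 L'.2
  have hd : Disjoint W L'.1 := disjoint_of_subset_right hL'.1 disjoint_compl_right
  have h := G.coef_recover i W hW hWk s p L'.1 hd hL'.2 (c s p (W ∪ L'.1)) (by
      rw [sum_union hd, Finset.sum_eq_zero hzero, zero_add] at hsum
      exact hsum)
    (fun m => by
      have hm : ∑ x ∈ W ∪ L'.1, G.coef i W ⟨s, p, m⟩ L'.1 x * c s p (W ∪ L'.1) x = 0 := hlabel m
      rw [sum_union hd, Finset.sum_eq_zero (s := W), zero_add] at hm
      · exact hm
      · exact fun x hx => by rw [hzero x hx, mul_zero])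
  funext x
  by_cases hx : x ∈ W ∪ L'.1
  · rcases mem_union.1 hx with hx | hx
    · exact hzero x hx
    · exact h x hx
  · exact hc.1 s p _ x fun h => hx h.2

/-- Let `c` vanish on the set `A` of `k` nodes.  Then `c` vanishes on a layer `L` if the
labelings for all `W` with `L ∩ A ⊆ W ⊆ A` are codewords of the Johnson graph codes. -/
theorem layer_eq_zero_of_check_eq_zero {c : Word F n ℓ} (hc : c ∈ G.concatCode)
    {A : Finset (Fin n)} (hAk : A.card = k) (hA : ∀ i p L, ∀ x ∈ A, c i p L x = 0)
    (i : ℕ) (p : Fin (copies ℓ i)) (L : Finset (Fin n))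
    (hcheck : ∀ W, L ∩ A ⊆ W → W ⊆ A → ∀ i, W.card + i = v → ∀ ch : Channel ℓ i,
      G.check i W ch (G.label i W ch c) = 0) : c i p L = 0 := by
  -- Downward induction on `|L ∩ A| + |L| ≤ 2 * n`. The hypothesis on the checks is inherited by
  -- layers with a larger intersection with `A`.
  suffices h : ∀ N i (p : Fin (copies ℓ i)) L, 2 * n < (L ∩ A).card + L.card + N →
      (∀ W, L ∩ A ⊆ W → W ⊆ A → ∀ i, W.card + i = v → ∀ ch : Channel ℓ i,
        G.check i W ch (G.label i W ch c) = 0) → c i p L = 0 from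
    h (2 * n + 1) i p L (by omega) hcheck
  intro N
  induction N with
  | zero =>
    intro i p L hN _
    have h1 := card_le_univ L
    have h2 := card_le_univ (L ∩ A)
    rw [Fintype.card_fin] at h1 h2
    omega
  | succ N ih =>
    intro i p L hN hcheck
    by_cases hL : L.card + i = v
    swap
    · exact funext fun x => hc.1 i p L x fun h => hL h.1
    by_cases hd0 : (L \ A).card = 0
    · have hLA : L ⊆ A := by rwa [card_eq_zero, sdiff_eq_empty_iff_subset] at hd0
      funext x
      by_cases hx : x ∈ L
      · exact hA i p L x (hLA hx)
      · exact hc.1 i p L x fun h => hx h.2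
    have hsplit : L ∩ A ∪ L \ A = L := by rw [union_comm, sdiff_union_inter]
    have hcard := card_sdiff_add_card_inter L A
    have hWA : L ∩ A ⊆ A := inter_subset_right
    have hWk : (L ∩ A).card ≤ k := hAk ▸ card_le_card hWA
    have hWi : (L ∩ A).card + (i + (L \ A).card) = v := by omega
    have hdA : Disjoint (L \ A) A := sdiff_disjoint
    -- From the viewpoint of `W = L ∩ A`, which has size `v - (i + |L \ A|)`, the layer `L` is
    -- helped with difference `d = |L \ A|`.
    let s : Fin (i + (L \ A).card) := ⟨i, by omega⟩
    have hs : i + (L \ A).card - s = (L \ A).card := by simp [s]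
    let L' : (L ∩ A)ᶜ.powersetCard (i + (L \ A).card - s) := ⟨L \ A, mem_powersetCard.2
      ⟨subset_compl_iff_disjoint_left.2 (disjoint_of_subset_left hWA hdA.symm), hs.symm⟩⟩
    have hlarge : ∀ i (p : Fin (copies ℓ i)) V, L ∩ A ⊆ V ∩ A →
        (L ∩ A).card + L.card < (V ∩ A).card + V.card → c i p V = 0 :=
      fun i p V hV hlt => ih i p V (by omega) fun W hW => hcheck W (hV.trans hW)
    have hsum : ∑ x ∈ L, c i p L x = 0 := by
      refine G.sum_layer_eq_zero hc p hL (card_pos.1 (by omega)) fun i p V hLV => ?_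
      have hsub := inter_subset_inter_right (u := A) hLV.1
      exact hlarge i p V hsub (add_lt_add_of_le_of_lt (card_le_card hsub) (card_lt_card hLV))
    have hlabel : ∀ m, G.label (i + (L \ A).card) (L ∩ A) ⟨s, p, m⟩ c L' = 0 := by
      intro m
      let ch : Channel ℓ (i + (L \ A).card) := ⟨s, p, m⟩
      have hAW : (A \ (L ∩ A)).card = k - (L ∩ A).card := by
        rw [card_sdiff_of_subset hWA, hAk]
      have hinj := (G.check_isJohnsonGraphCode _ _ hWi hWk ch (A \ (L ∩ A))
        (subset_compl_iff_disjoint_left.2 disjoint_sdiff) hAW).1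
      -- On the information set the layers `W ∪ V` have the size of `L` but contain a further node
      -- of `A`, so the induction hypothesis makes their labels zero.
      have heq := @hinj ⟨_, LinearMap.mem_ker.2 (hcheck _ subset_rfl hWA _ hWi ch)⟩ 0 (by
        funext ⟨V, hV⟩
        rw [← hAW, genBall_eq_compl] at hV
        obtain ⟨x, hxV, hxA⟩ := not_disjoint_iff.1 hV
        have hV' := mem_powersetCard.1 V.2
        have hdV : Disjoint (L ∩ A) V.1 := subset_compl_iff_disjoint_left.1 hV'.1
        refine G.label_eq_zero_of_layer_eq_zero ch V (hlarge _ _ _ ?_ ?_)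
        · exact subset_inter subset_union_left hWA
        · refine add_lt_add_of_lt_of_le (card_lt_card ⟨subset_inter subset_union_left hWA,
            fun h => (mem_sdiff.1 hxA).2 (h (mem_inter.2
              ⟨mem_union_right _ hxV, (mem_sdiff.1 hxA).1⟩))⟩) ?_
          rw [card_union_of_disjoint hdV, hV'.2]
          change L.card ≤ (L ∩ A).card + (i + (L \ A).card - s)
          omega)
      exact congrFun (congrArg Subtype.val heq) L'
    have hfin := G.layer_eq_zero_of_label_eq_zero hc hWi hWk s p L' (fun x hx => hA _ _ _ x
      (hWA hx)) (by
        change ∑ x ∈ L ∩ A ∪ L \ A, c i p (L ∩ A ∪ L \ A) x = 0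
        rwa [hsplit]) hlabel
    change c i p (L ∩ A ∪ L \ A) = 0 at hfin
    rwa [hsplit] at hfin

/-- The helper symbols of a nonempty layer, all stored in nodes where `c` vanishes, are zero. -/
theorem check_label_eq_zero {c : Word F n ℓ} (hc : c ∈ G.concatCode) {i : ℕ}
    {W : Finset (Fin n)} (hW : W.card + i = v) (hne : W.Nonempty)
    (hzero : ∀ p, ∀ x ∈ W, c i p W x = 0) (ch : Channel ℓ i) :
    G.check i W ch (G.label i W ch c) = 0 := by
  have hpos := hne.card_pos
  have h0 : 0 < i := lt_of_le_of_lt (Nat.zero_le _) ch.src.2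
  have hv : i < v := by omega
  have h : ∀ h : Helper ℓ i, G.check i W h.1 (G.label i W h.1 c) h.2 = 0 := fun h => by
    -- Since `assign` is a bijection, every helper symbol is the check sum of `W` in some copy.
    have h3 := hc.2.2 i h0 hv ((G.assign i h0 hv).symm h) W hW
    rw [Equiv.apply_symm_apply, Finset.sum_eq_zero (hzero _)] at h3
    exact h3.symm
  exact funext fun j => h ⟨ch, j⟩

/-- Any `k` nodes recover all symbols in the layers that they meet. -/
theorem layer_eq_of_agree {A : Finset (Fin n)} (hAk : A.card = k) {c c' : Word F n ℓ}
    (hc : c ∈ G.concatCode) (hc' : c' ∈ G.concatCode)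
    (h : ∀ i p L, ∀ x ∈ A, c i p L x = c' i p L x) (i : ℕ) (p : Fin (copies ℓ i))
    (L : Finset (Fin n)) (hL : (L ∩ A).Nonempty) : c i p L = c' i p L := by
  have hsub := sub_mem hc hc'
  have hA : ∀ i p L, ∀ x ∈ A, (c - c') i p L x = 0 := fun i p L x hx =>
    sub_eq_zero.2 (h i p L x hx)
  exact sub_eq_zero.1 (G.layer_eq_zero_of_check_eq_zero hsub hAk hA i p L
    fun W hW hWA i hi => G.check_label_eq_zero hsub hi (hL.mono hW)
      fun p x hx => hA i p W x (hWA hx))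

theorem mem_dataCode {c : Word F n ℓ} :
    c ∈ G.dataCode ↔
      c ∈ G.concatCode ∧ ∀ ch : Channel ℓ v, G.check v ∅ ch (G.label v ∅ ch c) = 0 := by
  simp [dataCode, Submodule.mem_iInf]

/-- Any `k` nodes recover the data. -/
theorem eq_of_agree {A : Finset (Fin n)} (hAk : A.card = k) {c c' : Word F n ℓ}
    (hc : c ∈ G.dataCode) (hc' : c' ∈ G.dataCode)
    (h : ∀ i p L, ∀ x ∈ A, c i p L x = c' i p L x) : c = c' := by
  obtain ⟨hsub, hdata⟩ := G.mem_dataCode.1 (sub_mem hc hc')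
  have hA : ∀ i p L, ∀ x ∈ A, (c - c') i p L x = 0 := fun i p L x hx =>
    sub_eq_zero.2 (h i p L x hx)
  funext i p L
  refine sub_eq_zero.1 (G.layer_eq_zero_of_check_eq_zero hsub hAk hA i p L
    fun W hW hWA i hi => ?_)
  rcases W.eq_empty_or_nonempty with rfl | hne
  · obtain rfl : i = v := by simpa using hi
    exact hdata
  · exact G.check_label_eq_zero hsub hi hne fun p x hx => hA i p W x (hWA hx)

end Gluing
end LayeredCode
end

/-! ### The dimension of the data code. -/

noncomputable section

namespace LayeredCode

/-- The layers, in all copies of the layered codes. -/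
abbrev Layer (n v ℓ : ℕ) : Type :=
  Σ i : Fin v, Fin (copies ℓ i) × {L : Finset (Fin n) // L.card + i = v}

/-- The places of the symbols in all layers. -/
abbrev Place (n v ℓ : ℕ) : Type := Σ q : Layer n v ℓ, q.2.2.1

/-- The places of the labels for the empty layer. -/
abbrev EmptyLabel (n v ℓ : ℕ) : Type :=
  Σ ch : Channel ℓ v, (∅ᶜ : Finset (Fin n)).powersetCard (v - ch.src)

theorem sum_layer (n v ℓ : ℕ) (g : Fin v → ℕ) :
    ∑ q : Layer n v ℓ, g q.1 = ∑ i : Fin v, copies ℓ i * n.choose (v - i) * g i := by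
  have hcard : ∀ i : Fin v, Fintype.card {L : Finset (Fin n) // L.card + i = v} =
      n.choose (v - i) := by
    intro i
    have h := Fintype.card_finset_len (α := Fin n) (v - i)
    rw [Fintype.card_fin] at h
    rw [← h]
    exact Fintype.card_congr (Equiv.subtypeEquivRight fun L => by omega)
  rw [Fintype.sum_sigma]
  refine Finset.sum_congr rfl fun i _ => ?_
  change ∑ _y, g i = _
  rw [Finset.sum_const, smul_eq_mul, card_univ, Fintype.card_prod, Fintype.card_fin, hcard]

theorem card_emptyLabel (n v ℓ : ℕ) : Fintype.card (EmptyLabel n v ℓ) =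
    ∑ i : Fin v, copies ℓ i * (n.choose (v - i) * (v - i - 1)) := by
  rw [Fintype.card_sigma]
  simp_rw [Fintype.card_coe, card_powersetCard, compl_empty, card_univ, Fintype.card_fin]
  rw [sum_channel ℓ v fun s : Fin v => n.choose (v - s)]
  exact Finset.sum_congr rfl fun i _ => by rw [smul_eq_mul]; ring

/-- A layer of size `u ≥ 1` has `u = 1 + (u - 1)` symbols: one for its check sum and one for each of
its labels with `W = ∅`, where `d = u`. -/
theorem card_place (n v ℓ : ℕ) : Fintype.card (Place n v ℓ) =
    Fintype.card (Layer n v ℓ) + Fintype.card (EmptyLabel n v ℓ) := by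
  have h : ∀ q : Layer n v ℓ, Fintype.card q.2.2.1 = v - q.1 := fun q => by
    have := q.2.2.2
    rw [Fintype.card_coe]
    omega
  rw [Fintype.card_sigma, card_emptyLabel, Fintype.card_eq_sum_ones (α := Layer n v ℓ)]
  simp_rw [h]
  rw [sum_layer n v ℓ fun i => v - i, sum_layer n v ℓ fun _ => 1, ← Finset.sum_add_distrib]
  refine Finset.sum_congr rfl fun i _ => ?_
  obtain ⟨d, hd⟩ : ∃ d, v - (i : ℕ) = d + 1 := ⟨v - i - 1, by omega⟩
  rw [hd, Nat.add_sub_cancel]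
  ring

variable {F : Type*} [Field F] {n v k ℓ : ℕ}

/-- The word with given symbols in the layers. -/
def wordOfSymbols : (Place n v ℓ → F) →ₗ[F] Word F n ℓ where
  toFun f i p L x := if h : i < v ∧ L.card + i = v ∧ x ∈ L then
    f ⟨⟨⟨i, h.1⟩, p, ⟨L, h.2.1⟩⟩, ⟨x, h.2.2⟩⟩ else 0
  map_add' f g := by
    funext i p L x
    simp only [Pi.add_apply]
    split_ifs <;> simp
  map_smul' a f := by
    funext i p L x
    simp only [Pi.smul_apply, RingHom.id_apply]
    split_ifs <;> simp

theorem wordOfSymbols_apply (f : Place n v ℓ → F) (q : Layer n v ℓ) (x : q.2.2.1) :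
    wordOfSymbols f q.1 q.2.1 q.2.2.1 x = f ⟨q, x⟩ :=
  dif_pos ⟨q.1.2, q.2.2.2, x.2⟩

theorem wordOfSymbols_apply_of_not (f : Place n v ℓ → F) (i : ℕ) (p : Fin (copies ℓ i))
    (L : Finset (Fin n)) (x : Fin n) (h : ¬(L.card + i = v ∧ x ∈ L)) :
    wordOfSymbols f i p L x = 0 :=
  dif_neg fun h' => h h'.2

theorem wordOfSymbols_injective :
    Function.Injective (wordOfSymbols : (Place n v ℓ → F) →ₗ[F] Word F n ℓ) := by
  intro f g h
  funext ⟨q, x⟩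
  rw [← wordOfSymbols_apply f, ← wordOfSymbols_apply g, h]

theorem exists_wordOfSymbols_eq (c : Word F n ℓ)
    (hc : ∀ i p L x, ¬(L.card + i = v ∧ x ∈ L) → c i p L x = 0) :
    ∃ f : Place n v ℓ → F, wordOfSymbols f = c := by
  refine ⟨fun q => c q.1.1 q.1.2.1 q.1.2.2.1 q.2, ?_⟩
  funext i p L x
  by_cases h : L.card + i = v ∧ x ∈ L
  -- A layer that contains a node has positive size, so `i < v`; levels `i ≥ v` hold no symbols.
  · have hpos := card_pos.2 ⟨x, h.2⟩
    exact dif_pos ⟨by omega, h⟩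
  · rw [wordOfSymbols_apply_of_not _ _ _ _ _ h, hc i p L x h]

namespace Gluing

variable (G : Gluing F n v k ℓ)

/-- The helper symbol that a copy of a layer has to store, `0` for the layers of size `v`. -/
def helperSymbol (q : Layer n v ℓ) : Word F n ℓ →ₗ[F] F :=
  if h : 0 < (q.1 : ℕ) then
    LinearMap.proj (G.assign q.1 h q.1.2 q.2.1).2 ∘ₗ
      G.check q.1 q.2.2.1 (G.assign q.1 h q.1.2 q.2.1).1 ∘ₗ
        G.label q.1 q.2.2.1 (G.assign q.1 h q.1.2 q.2.1).1
  else 0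

/-- The defects of the check sums of all layers. -/
def defect : (Place n v ℓ → F) →ₗ[F] (Layer n v ℓ → F) :=
  LinearMap.pi fun q =>
    (∑ x : q.2.2.1, LinearMap.proj ⟨q, x⟩) - G.helperSymbol q ∘ₗ wordOfSymbols

/-- The labels for the empty layer. -/
def emptyLabel : (Place n v ℓ → F) →ₗ[F] (EmptyLabel n v ℓ → F) :=
  LinearMap.pi fun q => LinearMap.proj q.2 ∘ₗ G.label v ∅ q.1 ∘ₗ wordOfSymbols

theorem defect_apply (f : Place n v ℓ → F) (q : Layer n v ℓ) :
    G.defect f q = ∑ x ∈ q.2.2.1, wordOfSymbols f q.1 q.2.1 q.2.2.1 x -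
      G.helperSymbol q (wordOfSymbols f) := by
  rw [← Finset.sum_coe_sort q.2.2.1]
  simp_rw [wordOfSymbols_apply]
  simp [defect, LinearMap.sum_apply]

theorem wordOfSymbols_mem_concatCode (hv : 0 < v) (f : Place n v ℓ → F) :
    wordOfSymbols f ∈ G.concatCode ↔ G.defect f = 0 := by
  constructor
  · rintro ⟨_, h2, h3⟩
    funext ⟨⟨i, hi⟩, p, ⟨L, hL⟩⟩
    rw [defect_apply, Pi.zero_apply, sub_eq_zero]
    rcases Nat.eq_zero_or_pos i with rfl | h0
    · exact h2 p L hL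
    · rw [helperSymbol, dif_pos h0]
      exact h3 i h0 hi p L hL
  · intro h
    refine ⟨wordOfSymbols_apply_of_not f, fun p L hL => ?_, fun i h0 hi p L hL => ?_⟩
    · have hq := congrFun h ⟨⟨0, hv⟩, p, ⟨L, hL⟩⟩
      rw [defect_apply, Pi.zero_apply, sub_eq_zero, helperSymbol, dif_neg (lt_irrefl 0)] at hq
      exact hq
    · have hq := congrFun h ⟨⟨i, hi⟩, p, ⟨L, hL⟩⟩
      rw [defect_apply, Pi.zero_apply, sub_eq_zero, helperSymbol, dif_pos h0] at hq
      exact hq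

/-- The labels for the empty layer determine a word of the concatenated code. -/
theorem eq_zero_of_label_empty_eq_zero {c : Word F n ℓ} (hc : c ∈ G.concatCode)
    (hlabel : ∀ ch : Channel ℓ v, G.label v ∅ ch c = 0) : c = 0 := by
  suffices h : ∀ N i (p : Fin (copies ℓ i)) (L : Finset (Fin n)), n < L.card + N →
      c i p L = 0 by
    funext i p L
    exact h (n + 1) i p L (by omega)
  intro N
  induction N with
  | zero =>
    intro i p L hN
    have := card_le_univ L
    rw [Fintype.card_fin] at this
    omega
  | succ N ih =>
    intro i p L hN
    by_cases hL : L.card + i = v ∧ L.Nonempty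
    · obtain ⟨hLi, hne⟩ := hL
      have hpos := hne.card_pos
      -- Downward induction on `|L|`: helper symbols of `L` involve larger layers only. With zero
      -- check sum and zero labels for `W = ∅`, all symbols of `L` vanish.
      have hsum := G.sum_layer_eq_zero hc p hLi hne fun i p V hV =>
        ih i p V (by have := card_lt_card hV; omega)
      let s : Fin v := ⟨i, by omega⟩
      let L' : (∅ᶜ : Finset (Fin n)).powersetCard (v - s) := ⟨L, mem_powersetCard.2
        ⟨by simp, by change L.card = v - i; omega⟩⟩
      have h := G.layer_eq_zero_of_label_eq_zero hc (i := v) (W := ∅) (by simp) (by simp)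
        s p L' (by simp) (by rwa [empty_union]) fun m => congrFun (hlabel ⟨s, p, m⟩) L'
      rwa [empty_union] at h
    · refine funext fun x => hc.1 i p L x fun h => hL ⟨h.1, ⟨x, h.2⟩⟩

theorem defect_prod_emptyLabel_injective (hv : 0 < v) :
    Function.Injective (G.defect.prod G.emptyLabel) := by
  rw [← LinearMap.ker_eq_bot, LinearMap.ker_eq_bot']
  intro f hf
  have h1 : G.defect f = 0 := congrArg Prod.fst hf
  have h2 : G.emptyLabel f = 0 := congrArg Prod.snd hf
  refine wordOfSymbols_injective ?_
  rw [map_zero]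
  exact G.eq_zero_of_label_empty_eq_zero ((G.wordOfSymbols_mem_concatCode hv f).2 h1)
    fun ch => funext fun L' => congrFun h2 ⟨ch, L'⟩

/-- The defects of the check sums and the labels for the empty layer can be prescribed. -/
theorem defect_prod_emptyLabel_surjective (hv : 0 < v) :
    Function.Surjective (G.defect.prod G.emptyLabel) := by
  refine (LinearMap.injective_iff_surjective_of_finrank_eq_finrank ?_).1
    (G.defect_prod_emptyLabel_injective hv)
  rw [Module.finrank_prod, Module.finrank_fintype_fun_eq_card,
    Module.finrank_fintype_fun_eq_card, Module.finrank_fintype_fun_eq_card, card_place]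

/-- The helper symbols of the empty layer as a function of its labels. -/
def emptyHelper : (EmptyLabel n v ℓ → F) →ₗ[F] (Helper ℓ v → F) :=
  LinearMap.pi fun h => LinearMap.proj h.2 ∘ₗ G.check v ∅ h.1 ∘ₗ
    LinearMap.pi fun L' => LinearMap.proj ⟨h.1, L'⟩

/-- Different channels use disjoint sets of labels, so their surjective checks can be solved
separately. -/
theorem emptyHelper_surjective : Function.Surjective G.emptyHelper := by
  intro t
  choose g hg using fun ch : Channel ℓ v =>
    G.check_surjective v ∅ (by simp) (by simp) ch fun j => t ⟨ch, j⟩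
  exact ⟨fun q => g q.1 q.2, funext fun h => congrFun (hg h.1) h.2⟩

/-- All checks of the data code. -/
def dataCheck : (Place n v ℓ → F) →ₗ[F] (Layer n v ℓ → F) × (Helper ℓ v → F) :=
  LinearMap.prodMap LinearMap.id G.emptyHelper ∘ₗ G.defect.prod G.emptyLabel

theorem dataCheck_surjective (hv : 0 < v) : Function.Surjective G.dataCheck :=
  (Function.surjective_id.prodMap G.emptyHelper_surjective).comp
    (G.defect_prod_emptyLabel_surjective hv)

theorem dataCode_eq_map (hv : 0 < v) :
    G.dataCode = (LinearMap.ker G.dataCheck).map wordOfSymbols := by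
  have key : ∀ f, wordOfSymbols f ∈ G.dataCode ↔ G.dataCheck f = 0 := fun f => by
    rw [mem_dataCode, wordOfSymbols_mem_concatCode G hv, Prod.ext_iff]
    refine and_congr Iff.rfl ⟨fun h => funext fun q => congrFun (h q.1) q.2,
      fun h ch => funext fun j => congrFun h ⟨ch, j⟩⟩
  ext c
  constructor
  · intro hc
    obtain ⟨f, rfl⟩ := exists_wordOfSymbols_eq c ((G.mem_dataCode.1 hc).1.1)
    exact ⟨f, (key f).1 hc, rfl⟩
  · rintro ⟨f, hf, rfl⟩
    exact (key f).2 hf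

/-- Rank-nullity for the surjective `dataCheck`. The term `copies ℓ v` appears because the
recurrence at `i = v` also counts the helper symbols of the empty layer, though no copy can store
them. -/
theorem finrank_dataCode (hv : 0 < v) :
    Module.finrank F G.dataCode + copies ℓ v =
      ∑ i ∈ range v, copies ℓ i * (n.choose (v - i) * (v - i - 1)) := by
  have h1 := LinearMap.finrank_range_add_finrank_ker G.dataCheck
  rw [LinearMap.range_eq_top.2 (G.dataCheck_surjective hv), finrank_top, Module.finrank_prod,
    Module.finrank_fintype_fun_eq_card, Module.finrank_fintype_fun_eq_card,
    Module.finrank_fintype_fun_eq_card, card_helper ℓ v hv, card_place, card_emptyLabel,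
    Fin.sum_univ_eq_sum_range
      (fun i => copies ℓ i * (n.choose (v - i) * (v - i - 1)))] at h1
  have h2 := (Submodule.equivMapOfInjective wordOfSymbols wordOfSymbols_injective
    (LinearMap.ker G.dataCheck)).finrank_eq
  rw [G.dataCode_eq_map hv, ← h2]
  omega

end Gluing
end LayeredCode
end

theorem mainTheorem6 {F : Type*} [Field F] (n v k ℓ : ℕ) (hv : 2 ≤ v) (hvn : v ≤ n)
    (hk : k + 1 + ℓ = n) :
    -- the coefficients of `f_ℓ` are natural numbers
    (∀ i : ℕ, (LayeredCode.copies ℓ i : ℚ) = PowerSeries.coeff i (LayeredCode.genFun ℓ)) ∧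
    -- the construction can be carried out over every field with at least `n` elements
    (Nonempty (Fin n ↪ F) → Nonempty (LayeredCode.Gluing F n v k ℓ)) ∧
    ∀ G : LayeredCode.Gluing F n v k ℓ,
      -- any `k` nodes recover all symbols in all the layers that they meet
      (∀ A : Finset (Fin n), A.card = k →
        ∀ c ∈ G.concatCode, ∀ c' ∈ G.concatCode,
          (∀ i p L, ∀ x ∈ A, c i p L x = c' i p L x) →
          ∀ i p L, (L ∩ A).Nonempty → c i p L = c' i p L) ∧
      -- the dimension: the data symbols of all the layered codes, minus `a_v`
      Module.finrank F G.dataCode + LayeredCode.copies ℓ v =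
        ∑ i ∈ Finset.range v, LayeredCode.copies ℓ i * (n.choose (v - i) * (v - i - 1)) ∧
      -- any `k` nodes recover the data completely
      (∀ A : Finset (Fin n), A.card = k →
        ∀ c ∈ G.dataCode, ∀ c' ∈ G.dataCode,
          (∀ i p L, ∀ x ∈ A, c i p L x = c' i p L x) → c = c') := by
  exact ⟨LayeredCode.cast_copies ℓ, fun ⟨α⟩ => LayeredCode.nonempty_gluing hk α, fun G =>
    ⟨fun _ hA _ hc _ hc' h => G.layer_eq_of_agree hA hc hc' h, G.finrank_dataCode (by omega),
      fun _ hA _ hc _ hc' h => G.eq_of_agree hA hc hc' h⟩⟩
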